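/- Let $F$ be a global function field (a finite extension of $\mathbb{F}_q(t)$ for some finite field $\mathbb{F}_q$) and let $\mathfrak m$ be an effective divisor of $F$. Let $D_{\mathfrak m}(F)$ be the group of divisors of $F$ with support disjoint from the support of $\mathfrak m$, and let $P_{\mathfrak m}(F)$ be the subgroup of principal divisors $\operatorname{div}(f)$ with $f\in F^\times$ such that $\operatorname{ord}_{\mathfrak p}(f-1)\ge \operatorname{ord}_{\mathfrak p}\mathfrak m$ for all places $\mathfrak p$ in the support of $\mathfrak m$. Let $\mathrm{Cl}_{\mathfrak m}(F)=D_{\mathfrak m}(F)/P_{\mathfrak m}(F)$ be the ray class group of $F$ modulo $\mathfrak m$, and let $H$ be a subgroup of $\mathrm{Cl}_{\mathfrak m}(F)$. Then $H$ has finite index in $\mathrm{Cl}_{\mathfrak m}(F)$ if and only if $H$ contains the class of a divisor of nonzero degree. (Degrees of divisors are taken over the full constant field of $F$.) -/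

import Mathlib

/-!
Places, divisors and ray class groups of an algebraic function field `F` over a field `k`.
-/

noncomputable section

open scoped WithZero

namespace GlobalFunctionField

variable (k F : Type*) [Field k] [Field F] [Algebra k F]

/-- The full constant field of `F/k`: the algebraic closure of `k` in `F`. -/
abbrev constantField : IntermediateField k F := algebraicClosure k F

/-- A place of `F/k`: a discrete valuation ring that contains `k` and has fraction field `F`. -/
@[ext]
structure Place where
  /-- The valuation ring of the place. -/
  ring : ValuationSubring F
  algebraMap_mem : ∀ a : k, algebraMap k F a ∈ ring
  isDVR : IsDiscreteValuationRing ring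

attribute [instance] Place.isDVR

variable {k F}

namespace Place

variable (P : Place k F)

/-- The valuation ring of a place contains the full constant field. -/
theorem mem_ring_of_mem_constantField (x : F) (hx : x ∈ constantField k F) : x ∈ P.ring := by
  have h1 : IsIntegral k x := (mem_algebraicClosure_iff.mp hx).isIntegral
  obtain ⟨p, hp, hpx⟩ := h1
  let φ : k →+* P.ring := (algebraMap k F).codRestrict P.ring P.algebraMap_mem
  have h2 : IsIntegral P.ring x := by
    refine ⟨p.map φ, hp.map φ, ?_⟩
    rw [Polynomial.eval₂_map]
    exact hpx
  obtain ⟨y, hy⟩ := IsIntegrallyClosed.isIntegral_iff.mp h2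
  rw [← hy]
  exact y.2

/-- The embedding of the full constant field into the residue field of a place. -/
def constantToResidue : constantField k F →+* IsLocalRing.ResidueField P.ring :=
  (IsLocalRing.residue P.ring).comp
    ((algebraMap (constantField k F) F).codRestrict P.ring
      fun x => P.mem_ring_of_mem_constantField x x.2)

/-- The degree of a place: the dimension of its residue field over the full constant field. -/
def degree : ℕ :=
  letI := P.constantToResidue.toAlgebra
  Module.finrank (constantField k F) (IsLocalRing.ResidueField P.ring)

/-- The normalized multiplicative valuation of a place. -/
def valuation : Valuation F ℤᵐ⁰ :=
  (IsDiscreteValuationRing.maximalIdeal P.ring).valuation F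

/-- The normalized order of vanishing of `f ≠ 0` at a place (the value at `f = 0` is not used). -/
def ord (f : F) : ℤ := -WithZero.log (P.valuation f)

theorem le_ord_iff {f : F} (hf : f ≠ 0) (n : ℤ) :
    n ≤ P.ord f ↔ P.valuation f ≤ WithZero.exp (-n) := by
  rw [← WithZero.log_le_iff_le_exp (by simpa using hf), ord]
  omega

theorem ord_mul {f g : F} (hf : f ≠ 0) (hg : g ≠ 0) : P.ord (f * g) = P.ord f + P.ord g := by
  have hf' : P.valuation f ≠ 0 := by simpa using hf
  have hg' : P.valuation g ≠ 0 := by simpa using hg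
  simp only [ord, map_mul, WithZero.log_mul hf' hg']
  ring

theorem ord_inv (f : F) : P.ord f⁻¹ = -P.ord f := by
  simp [ord, WithZero.log_inv]

theorem ord_one : P.ord (1 : F) = 0 := by
  simp [ord]

/-- `f ≡ 1` to order at least `n` at the place, that is `ord (f - 1) ≥ n`, where the order of
`0` is read as `∞`. -/
def CongrOne (n : ℤ) (f : F) : Prop := f = 1 ∨ n ≤ P.ord (f - 1)

theorem congrOne_iff (n : ℤ) (f : F) :
    P.CongrOne n f ↔ P.valuation (f - 1) ≤ WithZero.exp (-n) := by
  unfold CongrOne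
  by_cases h : f = 1
  · simp [h]
  · simp [h, P.le_ord_iff (sub_ne_zero.mpr h)]

theorem valuation_eq_one {f : F} (hf : f ≠ 0) (h : P.ord f = 0) : P.valuation f = 1 := by
  have hf' : P.valuation f ≠ 0 := by simpa using hf
  rw [← WithZero.exp_log hf']
  have : WithZero.log (P.valuation f) = 0 := by unfold ord at h; omega
  simp [this]

end Place

variable (k F)

/-- The divisor group of `F/k`: the free abelian group on the places. -/
abbrev Divisor := Place k F →₀ ℤ

variable {k F}

/-- The degree of a divisor. -/
def Divisor.degree (D : Divisor k F) : ℤ := D.sum fun P n => n * (P.degree : ℤ)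

/-- The group of divisors whose support is disjoint from the support of `m`. -/
def divisorsPrimeTo (m : Divisor k F) : AddSubgroup (Divisor k F) where
  carrier := {D | Disjoint D.support m.support}
  zero_mem' := by simp
  add_mem' {D E} hD hE := by
    classical
    exact Finset.disjoint_of_subset_left Finsupp.support_add
      (Finset.disjoint_union_left.mpr ⟨hD, hE⟩)
  neg_mem' {D} hD := by simpa using hD

theorem apply_eq_zero_of_mem {m D : Divisor k F} (hD : D ∈ divisorsPrimeTo m) {P : Place k F}
    (hP : P ∈ m.support) : D P = 0 := by
  by_contra h
  exact Finset.disjoint_left.mp (show Disjoint D.support m.support from hD)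
    (Finsupp.mem_support_iff.mpr h) hP

/-- `D` is the principal divisor of `f`. -/
def IsDivisorOf (D : Divisor k F) (f : F) : Prop := ∀ P : Place k F, D P = P.ord f

/-- The group of principal divisors `div f` with `ord_P (f - 1) ≥ ord_P m` for all places `P` in
the support of `m`, as a subgroup of the divisors prime to `m`. -/
def rayPrincipalDivisors (m : Divisor k F) : AddSubgroup (divisorsPrimeTo m) where
  carrier := {D | ∃ f : F, f ≠ 0 ∧ IsDivisorOf (D : Divisor k F) f ∧
    ∀ P ∈ m.support, P.CongrOne (m P) f}
  zero_mem' := ⟨1, one_ne_zero, fun P => by simp [P.ord_one], fun _ _ => Or.inl rfl⟩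
  add_mem' := by
    rintro ⟨D, hD⟩ ⟨E, hE⟩ ⟨f, hf, hDf, hf1⟩ ⟨g, hg, hEg, hg1⟩
    refine ⟨f * g, mul_ne_zero hf hg, fun P => ?_, fun P hP => ?_⟩
    · simp only [AddSubgroup.coe_add, Finsupp.add_apply, P.ord_mul hf hg, ← hDf P, ← hEg P]
    · have hv : P.valuation f = 1 :=
        P.valuation_eq_one hf ((hDf P).symm.trans (apply_eq_zero_of_mem hD hP))
      have h1 := (P.congrOne_iff _ _).mp (hf1 P hP)
      have h2 := (P.congrOne_iff _ _).mp (hg1 P hP)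
      rw [P.congrOne_iff, show f * g - 1 = f * (g - 1) + (f - 1) by ring]
      exact P.valuation.map_add_le (by simpa [hv] using h2) h1
  neg_mem' := by
    rintro ⟨D, hD⟩ ⟨f, hf, hDf, hf1⟩
    refine ⟨f⁻¹, inv_ne_zero hf, fun P => ?_, fun P hP => ?_⟩
    · simp only [NegMemClass.coe_neg, Finsupp.neg_apply, P.ord_inv, ← hDf P]
    · have hv : P.valuation f = 1 :=
        P.valuation_eq_one hf ((hDf P).symm.trans (apply_eq_zero_of_mem hD hP))
      have h1 := (P.congrOne_iff _ _).mp (hf1 P hP)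
      rw [P.congrOne_iff, show f⁻¹ - 1 = -(f⁻¹ * (f - 1)) by field_simp; ring]
      simpa [Valuation.map_neg, hv] using h1

/-- The ray class group of `F` modulo `m`. -/
abbrev RayClassGroup (m : Divisor k F) := divisorsPrimeTo m ⧸ rayPrincipalDivisors m

end GlobalFunctionField

end

noncomputable section

namespace GlobalFunctionField

open Polynomial IntermediateField
open scoped WithZero algebraAdjoinAdjoin

/-! ### Independence over `k(z)` and existence of zeros -/

section

variable {k F : Type*} [Field k] [Field F] [Algebra k F]

/-! If `H` has finite index `n`, choose a place `P` outside the support of `m`. The class of `n P`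
lies in `H`, and its degree is nonzero. Such a place exists because an element with poles at all of
a given nonempty finite set of places has its zeros elsewhere (`exists_place_notMem`).

Conversely, let `H'` be the preimage of `H` in the divisors prime to `m`, and `Q` the group of
principal divisors prime to `m`. The index of `H'` is `[H' + Q : H']` times the index of `H' + Q`.
The first factor is finite because `H'` contains the ray and `Q` modulo the ray is controlled by
residues modulo `m`, of which there are finitely many (`relIndex_rayPrincipalDivisors_ne_zero`). For
the second, a divisor `D` in `H'` of nonzero degree `d` moves any divisor into a window of `|d|`
consecutive degrees. Placed high enough, the window contains only divisors equivalent to effective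
ones, and there are finitely many effective divisors of bounded degree (`index_sup_ne_zero`).

This rests on three facts: principal divisors have degree zero (`baseDegree_principalDivisor`), a
form of Riemann's inequality (`exists_effective`), and finiteness of effective divisors of bounded
degree (`finite_setOf_effective`). The first two come from comparing zeros, poles and dimensions of
Riemann-Roch spaces with `[F : k(z)]`. Degrees are computed over `k`; passing to the full constant
field only divides them by a nonzero constant. -/

theorem aeval_mem_subring {O : Subring F}
    (hk : ∀ a : k, algebraMap k F a ∈ O) {z : F} (hz : z ∈ O) (p : k[X]) : aeval z p ∈ O := by
  rw [aeval_eq_sum_range]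
  refine sum_mem fun i _ => ?_
  rw [Algebra.smul_def]
  exact mul_mem (hk _) (pow_mem hz _)

/-- The hypothesis is `k`-independence modulo `zO`. In a relation with coefficients in `k[z]`, the
constant terms give a relation modulo `zO`, so they vanish; cancel `z` and induct on the degree. -/
theorem linearIndependent_adjoin_of_mod {ι : Type*} [Fintype ι] {O : Subring F}
    (hk : ∀ a : k, algebraMap k F a ∈ O) {z : F} (hz0 : z ≠ 0) (hz : z ∈ O) {y : ι → F}
    (hy : ∀ i, y i ∈ O) (h : ∀ c : ι → k, (∑ i, c i • y i) / z ∈ O → c = 0) :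
    LinearIndependent k⟮z⟯ y := by
  have key : ∀ (N : ℕ) (p : ι → k[X]), (∀ i, (p i).natDegree < N) →
      ∑ i, aeval z (p i) * y i = 0 → p = 0 := by
    intro N
    induction N with
    | zero =>
      intro p hp _
      funext i
      exact absurd (hp i) (by simp)
    | succ N ih =>
      intro p hp hs
      have e : ∀ i, aeval z (p i) * y i = z * (aeval z (p i).divX * y i) + (p i).coeff 0 • y i := by
        intro i
        conv_lhs => rw [← divX_mul_X_add (p i)]
        simp only [map_add, map_mul, aeval_X, aeval_C, Algebra.smul_def]
        ring
      simp_rw [e, Finset.sum_add_distrib, ← Finset.mul_sum] at hs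
      have h0 : (fun i => (p i).coeff 0) = 0 := by
        refine h _ ?_
        rw [eq_neg_of_add_eq_zero_right hs, neg_div, mul_div_cancel_left₀ _ hz0]
        exact neg_mem (sum_mem fun i _ => mul_mem (aeval_mem_subring hk hz _) (hy i))
      have h0' : ∀ i, (p i).coeff 0 = 0 := fun i => congrFun h0 i
      simp only [h0', zero_smul, Finset.sum_const_zero, add_zero, mul_eq_zero, hz0,
        false_or] at hs
      -- `divX` does not lower degree zero, so constant polynomials are settled directly.
      by_cases hN : N = 0
      · subst hN
        funext i
        rw [eq_C_of_natDegree_eq_zero (Nat.lt_one_iff.mp (hp i)), h0' i]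
        simp
      have := ih (fun i => (p i).divX) (fun i => by
        rw [natDegree_divX_eq_natDegree_tsub_one]; have := hp i; omega) hs
      funext i
      rw [← divX_mul_X_add (p i), h0' i, show (p i).divX = 0 from congrFun this i]
      simp
  rw [← LinearIndependent.iff_fractionRing (Algebra.adjoin k {z}) k⟮z⟯,
    Fintype.linearIndependent_iff]
  intro g hg
  have hp : ∀ i, ∃ p : k[X], aeval z p = (g i : F) := fun i => by
    have h : ∀ x ∈ Algebra.adjoin k {z}, ∃ p : k[X], aeval z p = x := fun x hx => by
      rwa [Algebra.adjoin_singleton_eq_range_aeval] at hx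
    exact h _ (g i).2
  choose p hp using hp
  have := key (Finset.univ.sup (fun i => (p i).natDegree) + 1) p
    (fun i => Nat.lt_succ_of_le (Finset.le_sup (f := fun i => (p i).natDegree) (Finset.mem_univ i)))
    (by simpa [hp, Algebra.smul_def] using hg)
  intro i
  apply Subtype.ext
  rw [← hp i, this]
  simp

variable [Algebra (RatFunc k) F] [IsScalarTower k (RatFunc k) F] [FunctionField k F]

/-- Lifts of `k`-independent classes modulo `z` are independent over `k(z)`, so the dimension is at
most `[F : k(z)]`. -/
theorem finite_quotient_span {V : ValuationSubring F} [Algebra k V] [IsScalarTower k V F] {z : V}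
    (hz : Transcendental k (z : F)) : Module.Finite k (V ⧸ Ideal.span {z}) := by
  have := FunctionField.finiteDimensional_of_adjoin_transcendental hz
  have hk : ∀ a : k, algebraMap k F a ∈ V.toSubring := fun a => by
    rw [IsScalarTower.algebraMap_apply k V F]
    exact (algebraMap k V a).2
  have hz0 : (z : F) ≠ 0 := fun h => hz (h ▸ isAlgebraic_zero)
  have hr : Module.rank k (V ⧸ Ideal.span {z}) ≤ Module.finrank k⟮(z : F)⟯ F := by
    refine rank_le fun s hs => ?_
    let y : s → V := fun i => Quotient.out (i : V ⧸ Ideal.span {z})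
    have hy : ∀ i : s, Ideal.Quotient.mk (Ideal.span {z}) (y i) = i := fun i => Quotient.out_eq _
    have := linearIndependent_adjoin_of_mod hk hz0 z.2 (y := fun i => (y i : F))
      (fun i => (y i).2) ?_
    · simpa using this.fintype_card_le_finrank
    · intro c hc
      rw [Fintype.linearIndependent_iff] at hs
      funext i
      refine hs c ?_ i
      have : ∑ i, c i • y i ∈ Ideal.span {z} := by
        rw [Ideal.mem_span_singleton]
        refine ⟨⟨_, hc⟩, Subtype.ext ?_⟩
        have e : ((∑ i, c i • y i : V) : F) = ∑ i, c i • (y i : F) := by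
          rw [← ValuationSubring.algebraMap_apply, map_sum]
          refine Finset.sum_congr rfl fun i _ => ?_
          rw [ValuationSubring.algebraMap_apply, Algebra.smul_def, Algebra.smul_def,
            IsScalarTower.algebraMap_apply k V F]
          rfl
        rw [e]
        exact (mul_div_cancel₀ _ hz0).symm
      rw [← Ideal.Quotient.eq_zero_iff_mem, map_sum] at this
      rw [← this]
      refine Finset.sum_congr rfl fun i _ => ?_
      rw [← Ideal.Quotient.mkₐ_eq_mk k, map_smul, Ideal.Quotient.mkₐ_eq_mk, hy]
  exact Module.rank_lt_aleph0_iff.mp (hr.trans_lt (Cardinal.natCast_lt_aleph0))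

/-- Since `z` is not a unit in `k[z]`, some valuation ring `V` containing `k[z]` has `z` as a
nonunit. It is Noetherian: a nonzero ideal contains a power of `z`, modulo which `V` is finite over
`k`. A Noetherian valuation ring that is not a field is discrete. -/
theorem exists_place_of_transcendental {z : F} (hz : Transcendental k z) :
    ∃ P : Place k F, z ∈ P.ring.nonunits := by
  have hz0 : z ≠ 0 := fun h => hz (h ▸ isAlgebraic_zero)
  let A : Subring F := (Algebra.adjoin k {z}).toSubring
  let z' : A := ⟨z, Algebra.self_mem_adjoin_singleton k z⟩
  have hI : Ideal.span {z'} ≠ ⊤ := by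
    rw [Ne, Ideal.span_singleton_eq_top]
    intro hu
    obtain ⟨⟨w, hw⟩, hw'⟩ := hu.exists_right_inv
    have hw2 : w ∈ Algebra.adjoin k {z} := hw
    rw [Algebra.adjoin_singleton_eq_range_aeval] at hw2
    obtain ⟨p, rfl⟩ := hw2
    have h1 : z * aeval z p = 1 := congrArg Subtype.val hw'
    have h2 : aeval z (X * p - 1) = 0 := by simp [h1]
    have h3 := (transcendental_iff.mp hz) _ h2
    have := congrArg (fun p => coeff p 0) h3
    simp at this
  obtain ⟨V, hV, hzV⟩ := Ideal.image_subset_nonunits_valuationSubring _ hI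
  have hzV : z ∈ V.nonunits := hzV ⟨z', Ideal.subset_span rfl, rfl⟩
  have hk : ∀ a, algebraMap k F a ∈ V := fun a => hV ((Algebra.adjoin k {z}).algebraMap_mem a)
  let φ : k →+* V := (algebraMap k F).codRestrict V hk
  let _ : Algebra k V := φ.toAlgebra
  have : IsScalarTower k V F := IsScalarTower.of_algebraMap_eq fun _ => rfl
  let ζ : V := ⟨z, V.nonunits_subset hzV⟩
  have hζ : ζ ∈ IsLocalRing.maximalIdeal V := ValuationSubring.coe_mem_nonunits_iff.mp hzV
  -- every nonzero element divides a power of `z`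
  have hdvd : ∀ x : V, x ≠ 0 → ∃ N : ℕ, x ∣ ζ ^ N := by
    intro x hx
    have := FunctionField.finiteDimensional_of_adjoin_transcendental hz
    have halg : IsAlgebraic (Algebra.adjoin k {z}) (x : F) :=
      isAlgebraic_adjoin_iff.mp (Algebra.IsAlgebraic.isAlgebraic (R := k⟮z⟯) (x : F))
    let _ : Algebra (Algebra.adjoin k {z}) V := (Subring.inclusion hV).toAlgebra
    have : IsScalarTower (Algebra.adjoin k {z}) V F := IsScalarTower.of_algebraMap_eq fun _ => rfl
    have halg' : IsAlgebraic (Algebra.adjoin k {z}) x :=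
      (isAlgebraic_algebraMap_iff (A := F) Subtype.val_injective).mp halg
    obtain ⟨⟨r, hr⟩, hr0, hxr⟩ := halg'.exists_nonzero_dvd (mem_nonZeroDivisors_of_ne_zero hx)
    have hr' := hr
    rw [Algebra.adjoin_singleton_eq_range_aeval] at hr'
    obtain ⟨p, rfl⟩ := hr'
    have hp : p ≠ 0 := by
      rintro rfl
      exact hr0 (Subtype.ext (map_zero _))
    obtain ⟨q, hpq, hq⟩ := exists_eq_pow_rootMultiplicity_mul_and_not_dvd p hp 0
    simp only [C_0, sub_zero, X_dvd_iff] at hpq hq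
    have e : algebraMap (Algebra.adjoin k {z}) V ⟨(aeval z).toRingHom p, hr⟩ = aeval ζ p := by
      apply Subtype.ext
      exact (aeval_algebraMap_apply F ζ p)
    refine ⟨rootMultiplicity 0 p, ?_⟩
    rw [e, hpq, map_mul, map_pow, aeval_X] at hxr
    -- The constant term of `q` is a nonzero element of `k`, and the other terms lie in the maximal
    -- ideal.
    have hu : IsUnit (aeval ζ q) := by
      rw [← divX_mul_X_add q, map_add, map_mul, aeval_X, aeval_C, add_comm]
      by_contra hnu
      have h1 := (IsLocalRing.maximalIdeal V).sub_mem ((IsLocalRing.mem_maximalIdeal _).mpr hnu)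
        ((IsLocalRing.maximalIdeal V).mul_mem_left (aeval ζ q.divX) hζ)
      rw [add_sub_cancel_right] at h1
      exact (IsLocalRing.mem_maximalIdeal _).mp h1 ((IsUnit.mk0 _ hq).map (algebraMap k V))
    exact (hu.dvd_mul_right).mp hxr
  have hnoeth : IsNoetherianRing V := by
    rw [isNoetherianRing_iff_ideal_fg]
    intro I
    by_cases hI0 : I = ⊥
    · subst hI0; exact Submodule.fg_bot
    obtain ⟨x, hx, hx0⟩ := Submodule.exists_mem_ne_zero_of_ne_bot hI0
    obtain ⟨N, hN⟩ := hdvd x hx0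
    -- The exponent `N + 1` is positive even for `N = 0`, which keeps the power of `z`
    -- transcendental.
    have hNI : Ideal.span {ζ ^ (N + 1)} ≤ I := by
      rw [Ideal.span_singleton_le_iff_mem]
      exact I.mem_of_dvd (hN.trans (pow_dvd_pow _ N.le_succ)) hx
    have : Module.Finite k (V ⧸ Ideal.span {ζ ^ (N + 1)}) :=
      finite_quotient_span (by simpa [ζ] using hz.pow N.succ_pos)
    have : IsNoetherian V (V ⧸ Ideal.span {ζ ^ (N + 1)}) :=
      isNoetherian_of_tower k inferInstance
    refine Submodule.fg_of_fg_map_of_fg_inf_ker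
      (Submodule.mkQ (Ideal.span {ζ ^ (N + 1)} : Submodule V V))
      (IsNoetherian.noetherian _) ?_
    rw [Submodule.ker_mkQ, inf_eq_right.mpr hNI]
    exact ⟨{ζ ^ (N+1)}, by simp [Ideal.span]⟩
  have hnf : ¬ IsField V := by
    intro hf
    rw [IsLocalRing.isField_iff_maximalIdeal_eq] at hf
    rw [hf] at hζ
    exact hz0 (congrArg Subtype.val ((Submodule.mem_bot V).mp hζ))
  have hdvr : IsDiscreteValuationRing V :=
    ((IsDiscreteValuationRing.TFAE V hnf).out 0 1).mpr (inferInstance : ValuationRing V)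
  exact ⟨⟨V, hk, hdvr⟩, hzV⟩

end

/-! ### Weak approximation and the bound on zeros -/

section

variable {k F : Type*} [Field k] [Field F] [Algebra k F]

theorem coe_smul_valuationSubring {V : ValuationSubring F} [Algebra k V] [IsScalarTower k V F]
    (c : k) (x : V) : ((c • x : V) : F) = c • (x : F) := by
  rw [Algebra.smul_def, Algebra.smul_def, IsScalarTower.algebraMap_apply k V F]
  rfl

namespace Place

variable (P : Place k F)

instance : Algebra k P.ring := ((algebraMap k F).codRestrict P.ring P.algebraMap_mem).toAlgebra

instance : IsScalarTower k P.ring F := IsScalarTower.of_algebraMap_eq fun _ => rfl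

theorem valuation_le_one_iff {x : F} : P.valuation x ≤ 1 ↔ x ∈ P.ring := by
  refine ⟨fun h => ?_, fun h => ?_⟩
  · obtain ⟨a, rfl⟩ := IsDiscreteValuationRing.exists_lift_of_le_one h
    exact a.2
  · exact (IsDiscreteValuationRing.maximalIdeal P.ring).valuation_le_one (K := F) ⟨x, h⟩

theorem valuation_coe_lt_one_iff {x : P.ring} :
    P.valuation (x : F) < 1 ↔ x ∈ IsLocalRing.maximalIdeal P.ring :=
  (IsDiscreteValuationRing.maximalIdeal P.ring).valuation_lt_one_iff_mem (K := F) x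

theorem valuation_lt_one_iff {x : F} : P.valuation x < 1 ↔ x ∈ P.ring.nonunits := by
  rw [ValuationSubring.mem_nonunits_iff_exists_mem_maximalIdeal]
  refine ⟨fun h => ⟨P.valuation_le_one_iff.mp h.le, P.valuation_coe_lt_one_iff.mp h⟩, ?_⟩
  rintro ⟨h, h'⟩
  exact P.valuation_coe_lt_one_iff.mpr h'

theorem valuation_algebraMap_le (a : k) : P.valuation (algebraMap k F a) ≤ 1 :=
  P.valuation_le_one_iff.mpr (P.algebraMap_mem a)

theorem valuation_smul_le (a : k) (x : F) : P.valuation (a • x) ≤ P.valuation x := by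
  rw [Algebra.smul_def, map_mul]
  exact mul_le_of_le_one_left' (P.valuation_algebraMap_le a)

theorem exists_uniformizer : ∃ x : F, P.valuation x = WithZero.exp (-1) :=
  (IsDiscreteValuationRing.maximalIdeal P.ring).valuation_exists_uniformizer F

theorem exists_valuation_eq (n : ℤ) : ∃ x : F, P.valuation x = WithZero.exp n := by
  obtain ⟨x, hx⟩ := P.exists_uniformizer
  exact ⟨x ^ (-n), by rw [map_zpow₀, hx, ← WithZero.exp_zsmul]; simp⟩

theorem valuation_eq_one_of_isAlgebraic {x : F} (hx : IsAlgebraic k x) (hx0 : x ≠ 0) :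
    P.valuation x = 1 := by
  have h : ∀ y : F, IsAlgebraic k y → P.valuation y ≤ 1 := fun y hy =>
    P.valuation_le_one_iff.mpr (P.mem_ring_of_mem_constantField y (mem_algebraicClosure_iff.mpr hy))
  refine le_antisymm (h x hx) ?_
  have := h x⁻¹ hx.inv
  rw [map_inv₀] at this
  exact (inv_le_one₀ (by simpa [zero_lt_iff] using hx0)).mp this

theorem valuation_eq_exp {x : F} (hx : x ≠ 0) : P.valuation x = WithZero.exp (-P.ord x) := by
  rw [ord, neg_neg, WithZero.exp_log (by simpa using hx)]

theorem transcendental_of_valuation_lt_one {x : F} (hx0 : x ≠ 0) (hx : P.valuation x < 1) :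
    Transcendental k x := fun h => hx.ne (P.valuation_eq_one_of_isAlgebraic h hx0)

/-- The degree of the residue field over the base field. -/
def residueDegree : ℕ := Module.finrank k (IsLocalRing.ResidueField P.ring)

theorem ext_of_le_one {P Q : Place k F} (h : ∀ x, P.valuation x ≤ 1 ↔ Q.valuation x ≤ 1) : P = Q :=
  Place.ext (ValuationSubring.ext _ _ fun x => by
    rw [← P.valuation_le_one_iff, ← Q.valuation_le_one_iff, h])

/-- The absolute value attached to a place. -/
def abv : AbsoluteValue F ℝ :=
  (IsDiscreteValuationRing.maximalIdeal P.ring).adicAbv (b := 2) one_lt_two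

theorem abv_le_iff {x y : F} : P.abv x ≤ P.abv y ↔ P.valuation x ≤ P.valuation y :=
  (WithZeroMulInt.toNNReal_strictMono (e := 2) one_lt_two).le_iff_le

theorem abv_lt_iff {x y : F} : P.abv x < P.abv y ↔ P.valuation x < P.valuation y :=
  (WithZeroMulInt.toNNReal_strictMono (e := 2) one_lt_two).lt_iff_lt

end Place

/-- Weak approximation: distinct places have distinct valuation rings, hence inequivalent nontrivial
absolute values, so `F` is dense in the product. -/
theorem exists_valuation_sub_le (S : Finset (Place k F)) (x : Place k F → F) (n : ℤ) :
    ∃ y : F, ∀ P ∈ S, P.valuation (y - x P) ≤ WithZero.exp n := by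
  choose π hπ using fun P : Place k F => P.exists_valuation_eq n
  have hd := AbsoluteValue.denseRange_algebraMap_pi (F := F) (v := fun P : S => (P : Place k F).abv)
    (fun P => ?_) (fun P Q hPQ h => ?_)
  · have hopen : IsOpen {w : (P : S) → WithAbs (P : Place k F).abv |
        ∀ P : S, dist (w P) (WithAbs.toAbs _ (x P)) < (P : Place k F).abv (π P)} := by
      simp only [Set.ofPred_forall]
      exact isOpen_iInter_of_finite fun P => isOpen_lt (by fun_prop) (by fun_prop)
    obtain ⟨y, hy⟩ := hd.exists_mem_open hopen ⟨fun P => WithAbs.toAbs _ (x P), fun P => by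
      simp only [dist_self]
      refine (P : Place k F).abv.pos fun h => ?_
      exact WithZero.exp_ne_zero (((hπ P).symm.trans (congrArg _ h)).trans (map_zero _))⟩
    refine ⟨y, fun P hP => ?_⟩
    have := hy ⟨P, hP⟩
    rw [← hπ]
    refine ((P.abv_lt_iff).mp ?_).le
    rwa [dist_eq_norm] at this
  · obtain ⟨x, hx⟩ := (P : Place k F).exists_uniformizer
    refine ⟨x, ?_, ?_⟩
    · rintro rfl
      exact WithZero.exp_ne_zero (hx.symm.trans (map_zero _))
    · intro h
      have := (P : Place k F).abv_lt_iff (x := x) (y := 1)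
      simp only [h, map_one, hx, lt_irrefl, false_iff] at this
      exact this (by simp [← WithZero.exp_zero, -WithZero.exp_neg])
  · refine hPQ (Subtype.ext (Place.ext_of_le_one fun x => ?_))
    have : (P : Place k F).abv x ≤ (P : Place k F).abv 1 ↔
        (Q : Place k F).abv x ≤ (Q : Place k F).abv 1 := h x 1
    rwa [Place.abv_le_iff, Place.abv_le_iff, map_one, map_one] at this

namespace Place

variable (P : Place k F)

/-- The family is `π ^ i * x j` with `i < e` and `x j` lifting a `k`-basis of the residue field.
Reducing a relation modulo `π` kills the coefficients with `i = 0`; then divide by `π`. -/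
theorem exists_linearIndependent_mod (e : ℕ) :
    ∃ b : Fin e × Fin P.residueDegree → F, (∀ i, P.valuation (b i) ≤ 1) ∧
      ∀ c : Fin e × Fin P.residueDegree → k,
        P.valuation (∑ i, c i • b i) ≤ WithZero.exp (-(e : ℤ)) → c = 0 := by
  obtain ⟨π, hπ⟩ := P.exists_uniformizer
  have hπ0 : P.valuation π ≠ 0 := by rw [hπ]; exact WithZero.exp_ne_zero
  have hπ1 : P.valuation π < 1 := by
    rw [hπ, ← WithZero.exp_zero, WithZero.exp_lt_exp]; norm_num
  obtain ⟨B, hB⟩ : ∃ B : Fin P.residueDegree → IsLocalRing.ResidueField P.ring,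
      LinearIndependent k B := by
    by_cases h : Module.Finite k (IsLocalRing.ResidueField P.ring)
    · exact ⟨Module.finBasis k _, (Module.finBasis k _).linearIndependent⟩
    -- By convention `finrank` is zero here, and the empty family suffices.
    · have h0 : P.residueDegree = 0 := Module.finrank_of_not_finite h
      rw [h0]
      exact ⟨Fin.elim0, linearIndependent_empty_type⟩
  choose x hx using fun j => IsLocalRing.residue_surjective (B j)
  have key : ∀ (e : ℕ) (c : ℕ → Fin P.residueDegree → k),
      P.valuation (∑ i ∈ Finset.range e, π ^ i * ∑ j, c i j • (x j : F)) ≤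
        WithZero.exp (-(e : ℤ)) → ∀ i < e, c i = 0 := by
    intro e
    induction e with
    | zero => intro c _ i hi; omega
    | succ e ih =>
      intro c hc
      have hmem : ∀ (d : Fin P.residueDegree → k), P.valuation (∑ j, d j • (x j : F)) ≤ 1 :=
        fun d => P.valuation.map_sum_le fun j _ => (P.valuation_smul_le _ _).trans
          (P.valuation_le_one_iff.mpr (x j).2)
      rw [Finset.sum_range_succ'] at hc
      simp_rw [pow_succ', mul_assoc, ← Finset.mul_sum] at hc
      simp only [pow_zero, one_mul] at hc
      set T := ∑ i ∈ Finset.range e, π ^ i * ∑ j, c (i + 1) j • (x j : F) with hT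
      have hT1 : P.valuation T ≤ 1 := P.valuation.map_sum_le fun i _ => by
        rw [map_mul, map_pow]
        exact mul_le_one' (pow_le_one' hπ1.le _) (hmem _)
      have h0 : c 0 = 0 := by
        have h1 : P.valuation (∑ j, c 0 j • (x j : F)) < 1 := by
          rw [← add_sub_cancel_left (π * T) (∑ j, c 0 j • (x j : F))]
          refine P.valuation.map_sub_lt (hc.trans_lt ?_) ?_
          · rw [← WithZero.exp_zero, WithZero.exp_lt_exp]; push_cast; omega
          · rw [map_mul]
            exact (mul_le_of_le_one_right' hT1).trans_lt hπ1
        have h2 : ((∑ j, c 0 j • x j : P.ring) : F) = ∑ j, c 0 j • (x j : F) := by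
          rw [← ValuationSubring.algebraMap_apply, map_sum]
          refine Finset.sum_congr rfl fun j _ => ?_
          exact coe_smul_valuationSubring (V := P.ring) (c 0 j) (x j)
        rw [← h2, P.valuation_coe_lt_one_iff, ← IsLocalRing.residue_eq_zero_iff, map_sum] at h1
        rw [Fintype.linearIndependent_iff] at hB
        funext j
        refine hB (c 0) ?_ j
        rw [← h1]
        refine Finset.sum_congr rfl fun j _ => ?_
        rw [← hx]
        rfl
      have h3 : P.valuation T ≤ WithZero.exp (-(e : ℤ)) := by
        simp only [h0, Pi.zero_apply, zero_smul, Finset.sum_const_zero, add_zero, map_mul,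
          hπ] at hc
        rw [show (-((e + 1 : ℕ) : ℤ)) = -1 + -(e : ℤ) by push_cast; ring, WithZero.exp_add] at hc
        exact (mul_le_mul_iff_right₀ (zero_lt_iff.mpr WithZero.exp_ne_zero)).mp hc
      intro i hi
      rcases i with _ | i
      · exact h0
      · exact ih (fun i => c (i + 1)) h3 i (by omega)
  refine ⟨fun p => π ^ (p.1 : ℕ) * (x p.2 : F), fun p => ?_, fun c hc => ?_⟩
  · rw [map_mul, map_pow]
    exact mul_le_one' (pow_le_one' hπ1.le _) (P.valuation_le_one_iff.mpr (x p.2).2)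
  · have := key e (fun i j => if h : i < e then c (⟨i, h⟩, j) else 0) (by
      convert hc using 2
      rw [Finset.sum_range, Fintype.sum_prod_type]
      refine Finset.sum_congr rfl fun i _ => ?_
      rw [Finset.mul_sum]
      refine Finset.sum_congr rfl fun j _ => ?_
      simp)
    funext ⟨i, j⟩
    simpa using congrFun (this i i.2) j

end Place

section FunctionField

variable [Algebra (RatFunc k) F] [IsScalarTower k (RatFunc k) F] [FunctionField k F]

/-- Local families independent modulo `z` at each `P ∈ S` are glued by weak approximation into one
family in the intersection of the valuation rings. It is independent modulo `z`, hence over `k(z)`,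
and the left side counts it. -/
theorem sum_residueDegree_le (S : Finset (Place k F)) {z : F} (hz : Transcendental k z)
    (hS : ∀ P ∈ S, P.valuation z ≤ 1) :
    ∑ P ∈ S, P.ord z * P.residueDegree ≤ Module.finrank k⟮z⟯ F := by
  have := FunctionField.finiteDimensional_of_adjoin_transcendental hz
  have hz0 : z ≠ 0 := fun h => hz (h ▸ isAlgebraic_zero)
  have hord : ∀ P ∈ S, 0 ≤ P.ord z := fun P hP => by
    rw [P.le_ord_iff hz0]; simpa using hS P hP
  choose b hb hbc using fun P : Place k F => P.exists_linearIndependent_mod (P.ord z).toNat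
  have hval : ∀ P ∈ S, P.valuation z = WithZero.exp (-((P.ord z).toNat : ℤ)) := fun P hP => by
    rw [P.valuation_eq_exp hz0, Int.toNat_of_nonneg (hord P hP)]
  let ι := Σ P : S, Fin ((P : Place k F).ord z).toNat × Fin (P : Place k F).residueDegree
  -- One precision for all places: an error of size `exp n` is divisible by `z` at every `P ∈ S`.
  let n : ℤ := -(∑ P ∈ S, P.ord z)
  have hn : ∀ P ∈ S, WithZero.exp n ≤ P.valuation z := fun P hP => by
    rw [P.valuation_eq_exp hz0, WithZero.exp_le_exp, neg_le_neg_iff]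
    exact Finset.single_le_sum (f := fun P : Place k F => P.ord z) hord hP
  classical
  choose y hy using fun i : ι => exists_valuation_sub_le S
    (fun P => if P = i.1 then b _ i.2 else 0) n
  let O : Subring F := ⨅ P : S, (P : Place k F).ring.toSubring
  have hO : ∀ x : F, x ∈ O ↔ ∀ P ∈ S, P.valuation x ≤ 1 := fun x => by
    simp [O, Subring.mem_iInf, Place.valuation_le_one_iff]
  have hli : LinearIndependent k⟮z⟯ y := by
    refine linearIndependent_adjoin_of_mod (O := O) (fun a => (hO _).mpr fun P _ =>
      P.valuation_algebraMap_le a) hz0 ((hO _).mpr hS) (fun i => (hO _).mpr fun P hP => ?_)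
      (fun c hc => ?_)
    · rw [← sub_add_cancel (y i) (if P = i.1 then b _ i.2 else 0)]
      refine P.valuation.map_add_le ((hy i P hP).trans ((hn P hP).trans (hS P hP))) ?_
      split_ifs with h
      · subst h
        exact hb _ _
      · simp
    -- At `P` the glued sum agrees modulo `z` with the local sum over the block of `P`, as the other
    -- blocks approximate `0` there.
    · have h1 : ∀ P : S, (fun j => c ⟨P, j⟩) = 0 := fun P => by
        refine hbc P _ ?_
        have hdiv := (hO _).mp hc P P.2
        rw [map_div₀, div_le_one₀ (zero_lt_iff.mpr (by simpa using hz0))] at hdiv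
        rw [← hval P P.2]
        have hs : ∑ j, c ⟨P, j⟩ • b P j =
            ∑ i : ι, c i • (if (P : Place k F) = i.1 then b _ i.2 else 0) := by
          rw [Fintype.sum_sigma, Finset.sum_eq_single P]
          · simp
          · intro Q _ hQ
            have : (P : Place k F) ≠ Q := fun h => hQ (Subtype.ext h.symm)
            simp [this]
          · simp
        rw [hs, ← sub_sub_cancel (∑ i, c i • y i)
          (∑ i : ι, c i • (if (P : Place k F) = i.1 then b _ i.2 else 0)), ← Finset.sum_sub_distrib]
        refine P.1.valuation.map_sub_le hdiv (P.1.valuation.map_sum_le fun i _ => ?_)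
        rw [← smul_sub]
        exact (P.1.valuation_smul_le _ _).trans ((hy i P P.2).trans (hn P P.2))
      funext ⟨P, j⟩
      exact congrFun (h1 P) j
  have hcard := hli.fintype_card_le_finrank
  rw [Fintype.card_sigma] at hcard
  simp only [Fintype.card_prod, Fintype.card_fin] at hcard
  rw [Finset.sum_coe_sort S (fun P : Place k F => (P.ord z).toNat * P.residueDegree)] at hcard
  zify at hcard
  refine le_trans (Finset.sum_le_sum fun P hP => ?_) hcard
  rw [Int.toNat_of_nonneg (hord P hP)]

end FunctionField

end

/-! ### Riemann-Roch spaces and divisors of functions -/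

section

variable {k F : Type*} [Field k] [Field F] [Algebra k F]

/-- The Riemann-Roch space of a divisor. -/
def riemannRochSpace (A : Divisor k F) : Submodule k F where
  carrier := {x | ∀ P : Place k F, P.valuation x ≤ WithZero.exp (A P)}
  zero_mem' P := by simp
  add_mem' hx hy P := P.valuation.map_add_le (hx P) (hy P)
  smul_mem' c x hx P := (P.valuation_smul_le c x).trans (hx P)

theorem mem_riemannRochSpace {A : Divisor k F} {x : F} :
    x ∈ riemannRochSpace A ↔ ∀ P : Place k F, P.valuation x ≤ WithZero.exp (A P) := Iff.rfl

theorem riemannRochSpace_mono {A B : Divisor k F} (h : A ≤ B) :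
    riemannRochSpace A ≤ riemannRochSpace B := fun _ hx P =>
  (hx P).trans (WithZero.exp_le_exp.mpr (h P))

/-- The degree of a divisor over the base field. -/
def baseDegree : Divisor k F →+ ℤ :=
  Finsupp.liftAddHom fun P => AddMonoidHom.mulRight (P.residueDegree : ℤ)

theorem baseDegree_apply (D : Divisor k F) :
    baseDegree D = D.sum fun P n => n * (P.residueDegree : ℤ) := rfl

theorem baseDegree_single (P : Place k F) (n : ℤ) :
    baseDegree (Finsupp.single P n) = n * P.residueDegree := by
  simp [baseDegree_apply]

theorem baseDegree_nonneg {D : Divisor k F} (hD : 0 ≤ D) : 0 ≤ baseDegree D :=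
  Finset.sum_nonneg fun P _ => mul_nonneg (hD P) (Int.natCast_nonneg _)

/-- The map takes the leading coefficient at `P`: multiply by an element of order `A P + 1` and
reduce. Its kernel consists of elements whose pole order at `P` drops by one, so adding `P` raises
the dimension by at most the residue degree. -/
theorem exists_ker_le_linearMap (A : Divisor k F) (P : Place k F) :
    ∃ φ : riemannRochSpace (A + Finsupp.single P 1) →ₗ[k] IsLocalRing.ResidueField P.ring,
      ∀ x, φ x = 0 → (x : F) ∈ riemannRochSpace A := by
  obtain ⟨π, hπ⟩ := P.exists_valuation_eq (-(A P + 1))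
  have hmem : ∀ x : riemannRochSpace (A + Finsupp.single P 1), π * (x : F) ∈ P.ring := fun x => by
    rw [← P.valuation_le_one_iff, map_mul, hπ]
    have := x.2 P
    simp only [Finsupp.add_apply, Finsupp.single_eq_same] at this
    calc _ ≤ WithZero.exp (-(A P + 1)) * WithZero.exp (A P + 1) := mul_le_mul_right this _
      _ = 1 := by rw [← WithZero.exp_add]; simp
  let ψ : riemannRochSpace (A + Finsupp.single P 1) →ₗ[k] P.ring :=
    { toFun := fun x => ⟨π * x, hmem x⟩
      map_add' := fun x y => Subtype.ext (mul_add _ _ _)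
      map_smul' := fun c x => Subtype.ext (by
        rw [RingHom.id_apply, coe_smul_valuationSubring]
        exact mul_smul_comm _ _ _) }
  refine ⟨(IsScalarTower.toAlgHom k P.ring (IsLocalRing.ResidueField P.ring)).toLinearMap ∘ₗ ψ,
    fun x hx Q => ?_⟩
  by_cases hQ : Q = P
  · subst hQ
    have h1 : IsLocalRing.residue Q.ring (ψ x) = 0 := hx
    rw [IsLocalRing.residue_eq_zero_iff, ← Q.valuation_coe_lt_one_iff] at h1
    change Q.valuation (π * x) < 1 at h1
    by_cases hx0 : (x : F) = 0
    · simp [hx0]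
    rw [map_mul, hπ, Q.valuation_eq_exp hx0, ← WithZero.exp_add, ← WithZero.exp_zero,
      WithZero.exp_lt_exp] at h1
    rw [Q.valuation_eq_exp hx0, WithZero.exp_le_exp]
    omega
  · have := x.2 Q
    rwa [Finsupp.add_apply, Finsupp.single_eq_of_ne hQ, add_zero] at this

theorem mul_mem_riemannRochSpace {A B : Divisor k F} {x y : F} (hx : x ∈ riemannRochSpace A)
    (hy : y ∈ riemannRochSpace B) : x * y ∈ riemannRochSpace (A + B) := fun P => by
  rw [map_mul, Finsupp.add_apply, WithZero.exp_add]
  exact mul_le_mul' (hx P) (hy P)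

section FunctionField

variable [Algebra (RatFunc k) F] [IsScalarTower k (RatFunc k) F] [FunctionField k F]

theorem Place.finite_quotient (P : Place k F) {x : P.ring} (hx0 : x ≠ 0)
    (hx : x ∈ IsLocalRing.maximalIdeal P.ring) : Module.Finite k (P.ring ⧸ Ideal.span {x}) :=
  finite_quotient_span (P.transcendental_of_valuation_lt_one
    (fun h => hx0 (Subtype.ext h)) (P.valuation_coe_lt_one_iff.mpr hx))

instance (P : Place k F) : Module.Finite k (IsLocalRing.ResidueField P.ring) := by
  obtain ⟨x, hx, hx0⟩ := Submodule.exists_mem_ne_zero_of_ne_bot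
    (IsDiscreteValuationRing.not_a_field P.ring)
  have := P.finite_quotient hx0 hx
  have hle : Ideal.span {x} ≤ IsLocalRing.maximalIdeal P.ring := by
    rwa [Ideal.span_singleton_le_iff_mem]
  exact Module.Finite.of_surjective (Ideal.Quotient.factorₐ k hle).toLinearMap
    (Ideal.Quotient.factor_surjective hle)

theorem Place.residueDegree_pos (P : Place k F) : 0 < P.residueDegree := Module.finrank_pos

/-- Each zero contributes at least one to the sum bounded by `[F : k(z)]`; an algebraic `z` has no
zeros. -/
theorem finite_setOf_valuation_lt_one {z : F} (hz0 : z ≠ 0) :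
    {P : Place k F | P.valuation z < 1}.Finite := by
  by_cases hz : Transcendental k z
  · by_contra hinf
    obtain ⟨S, hS, hcard⟩ := Set.Infinite.exists_subset_card_eq hinf
      (Module.finrank k⟮z⟯ F + 1)
    have h1 := sum_residueDegree_le S hz fun P hP => (hS hP).le
    have h2 : ∑ P ∈ S, (1 : ℤ) ≤ ∑ P ∈ S, P.ord z * P.residueDegree :=
      Finset.sum_le_sum fun P hP => by
        have h3 : P.valuation z < 1 := hS hP
        rw [P.valuation_eq_exp hz0, ← WithZero.exp_zero, WithZero.exp_lt_exp] at h3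
        have := P.residueDegree_pos
        nlinarith
    simp only [Finset.sum_const, hcard] at h2
    push_cast [nsmul_eq_mul] at h2
    linarith
  · convert Set.finite_empty
    refine Set.eq_empty_of_forall_notMem fun P hP => hz ?_
    exact P.transcendental_of_valuation_lt_one hz0 hP

theorem finite_setOf_ord_ne_zero (z : F) : {P : Place k F | P.ord z ≠ 0}.Finite := by
  by_cases hz0 : z = 0
  · simp [hz0, Place.ord]
  refine ((finite_setOf_valuation_lt_one hz0).union
    (finite_setOf_valuation_lt_one (inv_ne_zero hz0))).subset fun P hP => ?_
  simp only [Set.mem_union, Set.mem_ofPred_eq, P.valuation_eq_exp hz0,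
    P.valuation_eq_exp (inv_ne_zero hz0), ← WithZero.exp_zero, WithZero.exp_lt_exp, P.ord_inv]
  have : P.ord z ≠ 0 := hP
  omega

/-- The principal divisor of an element. -/
def principalDivisor (k : Type*) {F : Type*} [Field k] [Field F] [Algebra k F]
    [Algebra (RatFunc k) F] [IsScalarTower k (RatFunc k) F] [FunctionField k F] (z : F) :
    Divisor k F :=
  Finsupp.ofSupportFinite (fun P => P.ord z) (finite_setOf_ord_ne_zero z)

@[simp] theorem principalDivisor_apply (z : F) (P : Place k F) :
    principalDivisor k z P = P.ord z := rfl

/-- The divisor of zeros of an element. -/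
def zeroDivisor (k : Type*) {F : Type*} [Field k] [Field F] [Algebra k F]
    [Algebra (RatFunc k) F] [IsScalarTower k (RatFunc k) F] [FunctionField k F] (z : F) :
    Divisor k F :=
  (principalDivisor k z).mapRange (max · 0) rfl

@[simp] theorem zeroDivisor_apply (z : F) (P : Place k F) :
    zeroDivisor k z P = max (P.ord z) 0 := rfl

theorem zeroDivisor_nonneg (z : F) : 0 ≤ zeroDivisor k z := fun _ => le_max_right _ _

theorem principalDivisor_eq (z : F) :
    principalDivisor k z = zeroDivisor k z - zeroDivisor k z⁻¹ := by
  ext P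
  simp only [Finsupp.sub_apply, principalDivisor_apply, zeroDivisor_apply, P.ord_inv]
  omega

theorem mem_riemannRochSpace_iff {A : Divisor k F} {x : F} (hx : x ≠ 0) :
    x ∈ riemannRochSpace A ↔ 0 ≤ A + principalDivisor k x := by
  rw [mem_riemannRochSpace, Finsupp.le_def]
  refine forall_congr' fun P => ?_
  rw [P.valuation_eq_exp hx, WithZero.exp_le_exp]
  simp only [Finsupp.add_apply, principalDivisor_apply, Finsupp.coe_zero, Pi.zero_apply]
  omega

theorem mem_riemannRochSpace_zeroDivisor_inv (z : F) :
    z ∈ riemannRochSpace (zeroDivisor k z⁻¹) := by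
  by_cases hz : z = 0
  · rw [hz]; exact zero_mem _
  · rw [mem_riemannRochSpace_iff hz, principalDivisor_eq]
    simpa using zeroDivisor_nonneg z

theorem baseDegree_zeroDivisor_le {z : F} (hz : Transcendental k z) :
    baseDegree (zeroDivisor k z) ≤ Module.finrank k⟮z⟯ F := by
  have hz0 : z ≠ 0 := fun h => hz (h ▸ isAlgebraic_zero)
  refine le_trans (le_of_eq ?_) (sum_residueDegree_le (zeroDivisor k z).support hz fun P hP => ?_)
  · refine Finset.sum_congr rfl fun P hP => ?_
    rw [Finsupp.mem_support_iff, zeroDivisor_apply] at hP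
    rw [zeroDivisor_apply, max_eq_left (by omega)]
    rfl
  · rw [Finsupp.mem_support_iff, zeroDivisor_apply] at hP
    rw [P.valuation_eq_exp hz0, ← WithZero.exp_zero, WithZero.exp_le_exp]
    omega

/-- Otherwise `x⁻¹` is transcendental, and a zero of it is a pole of `x`. -/
theorem isAlgebraic_of_forall_valuation_le_one {x : F}
    (h : ∀ P : Place k F, P.valuation x ≤ 1) : IsAlgebraic k x := by
  by_contra hx
  obtain ⟨P, hP⟩ := exists_place_of_transcendental (z := x⁻¹)
    (fun h' => hx (by simpa using h'.inv))
  rw [← P.valuation_lt_one_iff, map_inv₀] at hP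
  have hx0 : x ≠ 0 := fun h => hx (h ▸ isAlgebraic_zero)
  exact hP.not_ge ((one_le_inv₀ (by simpa [zero_lt_iff] using hx0)).mpr (h P))

theorem riemannRochSpace_neg_single (P : Place k F) :
    riemannRochSpace (-Finsupp.single P 1) = ⊥ := by
  rw [eq_bot_iff]
  intro x hx
  by_contra hx0
  have hx1 : IsAlgebraic k x := isAlgebraic_of_forall_valuation_le_one fun Q => by
    refine (hx Q).trans ?_
    rw [← WithZero.exp_zero, WithZero.exp_le_exp]
    rw [Finsupp.neg_apply, neg_nonpos]
    exact Finsupp.single_nonneg.mpr zero_le_one Q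
  have h1 := P.valuation_eq_one_of_isAlgebraic hx1 hx0
  have h2 := hx P
  rw [h1, ← WithZero.exp_zero, WithZero.exp_le_exp] at h2
  simp at h2

theorem finite_and_finrank_add_single_one {A : Divisor k F} (P : Place k F)
    (hA : Module.Finite k (riemannRochSpace A)) :
    Module.Finite k (riemannRochSpace (A + Finsupp.single P 1)) ∧
      Module.finrank k (riemannRochSpace (A + Finsupp.single P 1)) ≤
        Module.finrank k (riemannRochSpace A) + P.residueDegree := by
  obtain ⟨φ, hφ⟩ := exists_ker_le_linearMap A P
  let ι : LinearMap.ker φ →ₗ[k] riemannRochSpace A :=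
    ((Submodule.subtype _).comp (LinearMap.ker φ).subtype).codRestrict _ fun x => hφ x.1 x.2
  have hι : Function.Injective ι := fun x y h =>
    Subtype.ext (Subtype.ext (congrArg (fun t : riemannRochSpace A => (t : F)) h))
  have hker : Module.Finite k (LinearMap.ker φ) := Module.Finite.of_injective ι hι
  have hfin : Module.Finite k (riemannRochSpace (A + Finsupp.single P 1)) :=
    ⟨Submodule.fg_of_fg_map_of_fg_inf_ker φ (IsNoetherian.noetherian _)
      (by rw [top_inf_eq]; exact Module.Finite.iff_fg.mp hker)⟩
  refine ⟨hfin, ?_⟩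
  rw [← LinearMap.finrank_range_add_finrank_ker φ, add_comm]
  exact add_le_add (LinearMap.finrank_le_finrank_of_injective hι) (Submodule.finrank_le _)

theorem finite_and_finrank_add {A B : Divisor k F} (hB : 0 ≤ B)
    (hA : Module.Finite k (riemannRochSpace A)) :
    Module.Finite k (riemannRochSpace (A + B)) ∧
      (Module.finrank k (riemannRochSpace (A + B)) : ℤ) ≤
        Module.finrank k (riemannRochSpace A) + baseDegree B := by
  have h1 : ∀ (P : Place k F) (n : ℕ) (A : Divisor k F), Module.Finite k (riemannRochSpace A) →
      Module.Finite k (riemannRochSpace (A + Finsupp.single P (n : ℤ))) ∧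
      (Module.finrank k (riemannRochSpace (A + Finsupp.single P (n : ℤ))) : ℤ) ≤
        Module.finrank k (riemannRochSpace A) + n * P.residueDegree := by
    intro P n A hA
    induction n with
    | zero =>
      have e : A + Finsupp.single P ((0 : ℕ) : ℤ) = A := by simp
      rw [e]
      exact ⟨hA, by simp⟩
    | succ n ih =>
      have h := finite_and_finrank_add_single_one P ih.1
      rw [add_assoc, ← Finsupp.single_add] at h
      refine ⟨by exact_mod_cast h.1, ?_⟩
      have h2 := h.2
      have h3 := ih.2
      push_cast at h2 h3 ⊢
      zify at h2
      linarith
  have h2 : ∀ S : Finset (Place k F),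
      Module.Finite k (riemannRochSpace (A + ∑ P ∈ S, Finsupp.single P (B P))) ∧
      (Module.finrank k (riemannRochSpace (A + ∑ P ∈ S, Finsupp.single P (B P))) : ℤ) ≤
        Module.finrank k (riemannRochSpace A) + ∑ P ∈ S, B P * P.residueDegree := by
    classical
    intro S
    induction S using Finset.induction_on with
    | empty =>
      rw [Finset.sum_empty, Finset.sum_empty, add_zero, add_zero]
      exact ⟨hA, le_rfl⟩
    | insert P S hP ih =>
      have h := h1 P (B P).toNat _ ih.1
      rw [Int.toNat_of_nonneg (hB P)] at h
      rw [Finset.sum_insert hP, Finset.sum_insert hP, add_comm (Finsupp.single P (B P)),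
        ← add_assoc]
      exact ⟨h.1, by linarith [h.2, ih.2]⟩
  have h3 := h2 B.support
  rwa [show ∑ P ∈ B.support, Finsupp.single P (B P) = B from Finsupp.sum_single B] at h3

theorem exists_transcendental (k F : Type*) [Field k] [Field F] [Algebra k F]
    [Algebra (RatFunc k) F] [IsScalarTower k (RatFunc k) F] [FunctionField k F] :
    ∃ t : F, Transcendental k t :=
  ⟨algebraMap (RatFunc k) F RatFunc.X, (transcendental_algebraMap_iff
    (algebraMap (RatFunc k) F).injective).mpr RatFunc.transcendental_X⟩

theorem nonempty_place (k F : Type*) [Field k] [Field F] [Algebra k F]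
    [Algebra (RatFunc k) F] [IsScalarTower k (RatFunc k) F] [FunctionField k F] :
    Nonempty (Place k F) := by
  obtain ⟨t, ht⟩ := exists_transcendental k F
  obtain ⟨P, _⟩ := exists_place_of_transcendental ht
  exact ⟨P⟩

/-- Start from `L(-P) = 0`, add `P` and then `A ⊔ 0`, and pass to the subspace `L(A)`. -/
instance (A : Divisor k F) : Module.Finite k (riemannRochSpace A) := by
  obtain ⟨P⟩ := nonempty_place k F
  have h0 : Module.Finite k (riemannRochSpace (-Finsupp.single P 1 : Divisor k F)) := by
    rw [riemannRochSpace_neg_single]; infer_instance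
  have h1 := (finite_and_finrank_add (B := Finsupp.single P 1 + A ⊔ 0)
    (add_nonneg (Finsupp.single_nonneg.mpr zero_le_one) le_sup_right) h0).1
  rw [← add_assoc, neg_add_cancel, zero_add] at h1
  exact Submodule.finiteDimensional_of_le (riemannRochSpace_mono (le_sup_left : A ≤ A ⊔ 0))

theorem finrank_riemannRochSpace_le_add {A B : Divisor k F} (h : A ≤ B) :
    (Module.finrank k (riemannRochSpace B) : ℤ) ≤
      Module.finrank k (riemannRochSpace A) + baseDegree (B - A) := by
  have := (finite_and_finrank_add (sub_nonneg.mpr h) (A := A) inferInstance).2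
  rwa [add_sub_cancel] at this

end FunctionField

end

/-! ### Degree of principal divisors and Riemann's inequality -/

section

variable {k F : Type*} [Field k] [Field F] [Algebra k F]
theorem pow_mem_riemannRochSpace {A : Divisor k F} {x : F} (hx : x ∈ riemannRochSpace A) (n : ℕ) :
    x ^ n ∈ riemannRochSpace (n • A) := by
  induction n with
  | zero => simp [mem_riemannRochSpace]
  | succ n ih => rw [pow_succ, succ_nsmul]; exact mul_mem_riemannRochSpace ih hx

theorem linearIndependent_gen_pow {z : F} (hz : Transcendental k z) :
    LinearIndependent k fun n : ℕ => AdjoinSimple.gen k z ^ n := by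
  have hg : Transcendental k (AdjoinSimple.gen k z) := fun h => hz (by
    simpa using h.algebraMap (A := F))
  have h := (Polynomial.basisMonomials k).linearIndependent.map'
    (aeval (AdjoinSimple.gen k z)).toLinearMap
    (LinearMap.ker_eq_bot.mpr (transcendental_iff_injective.mp hg))
  have e : (aeval (AdjoinSimple.gen k z)).toLinearMap ∘ Polynomial.basisMonomials k =
      fun n : ℕ => AdjoinSimple.gen k z ^ n := by
    funext n
    simp [aeval_monomial]
  rwa [e] at h

variable [Algebra (RatFunc k) F] [IsScalarTower k (RatFunc k) F] [FunctionField k F]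


/-- With `y` a basis of `F` over `k(z)` and `C` bounding the poles of its members, the products `z ^
i * y j` for `i ≤ m` are `k`-independent. The divisor `zeroDivisor k z⁻¹` is the pole divisor of
`z`. -/
theorem exists_finrank_mul_le {z : F} (hz : Transcendental k z) :
    ∃ C : Divisor k F, 0 ≤ C ∧ ∀ m : ℕ, Module.finrank k⟮z⟯ F * (m + 1) ≤
      Module.finrank k (riemannRochSpace (m • zeroDivisor k z⁻¹ + C)) := by
  have := FunctionField.finiteDimensional_of_adjoin_transcendental hz
  let y := Module.finBasis k⟮z⟯ F
  let C : Divisor k F := ∑ i, zeroDivisor k (y i)⁻¹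
  have hy : ∀ i, y i ∈ riemannRochSpace C := fun i =>
    riemannRochSpace_mono (Finset.single_le_sum (f := fun i => zeroDivisor k (y i)⁻¹)
      (fun i _ => zeroDivisor_nonneg _) (Finset.mem_univ i))
      (mem_riemannRochSpace_zeroDivisor_inv (y i))
  refine ⟨C, Finset.sum_nonneg fun i _ => zeroDivisor_nonneg _, fun m => ?_⟩
  have hmem : ∀ p : Fin (m + 1) × Fin (Module.finrank k⟮z⟯ F),
      AdjoinSimple.gen k z ^ (p.1 : ℕ) • y p.2 ∈
        riemannRochSpace (m • zeroDivisor k z⁻¹ + C) := fun p => by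
    have h1 : z ^ (p.1 : ℕ) ∈ riemannRochSpace (m • zeroDivisor k z⁻¹) :=
      riemannRochSpace_mono (nsmul_le_nsmul_left (zeroDivisor_nonneg _) (Nat.lt_succ_iff.mp p.1.2))
        (pow_mem_riemannRochSpace (mem_riemannRochSpace_zeroDivisor_inv z) _)
    simpa [Algebra.smul_def] using mul_mem_riemannRochSpace h1 (hy p.2)
  have hli := linearIndependent_smul
    ((linearIndependent_gen_pow hz).comp (fun i : Fin (m + 1) => (i : ℕ)) Fin.val_injective)
    y.linearIndependent
  have hli' : LinearIndependent k fun p => (⟨_, hmem p⟩ : riemannRochSpace _) :=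
    LinearIndependent.of_comp (Submodule.subtype _) hli
  simpa [mul_comm] using hli'.fintype_card_le_finrank

theorem finrank_le_baseDegree {z : F} (hz : Transcendental k z) :
    (Module.finrank k⟮z⟯ F : ℤ) ≤ baseDegree (zeroDivisor k z⁻¹) := by
  obtain ⟨C, hC, h⟩ := exists_finrank_mul_le hz
  -- The dimension of `L(m (z)_∞ + C)` is at least `[F : k(z)] (m + 1)` and at most `l + m deg
  -- (z)_∞`. If the degree were smaller than `[F : k(z)]`, these would already conflict at `m = l`.
  set l := Module.finrank k (riemannRochSpace C)
  have h1 := h l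
  have h2 := finrank_riemannRochSpace_le_add (A := C) (B := l • zeroDivisor k z⁻¹ + C)
    (le_add_of_nonneg_left (nsmul_nonneg (zeroDivisor_nonneg _) _))
  rw [add_sub_cancel_right, map_nsmul, nsmul_eq_mul] at h2
  have h3 : (0 : ℤ) ≤ baseDegree (zeroDivisor k z⁻¹) := baseDegree_nonneg (zeroDivisor_nonneg _)
  by_contra! hlt
  zify at h1
  have h4 : (0 : ℤ) ≤ l := Int.natCast_nonneg _
  nlinarith

/-- The two inequalities, applied to `z` and `z⁻¹`, close into a cycle, so `k(z) = k(z⁻¹)` is never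
needed. -/
theorem baseDegree_zeroDivisor {z : F} (hz : Transcendental k z) :
    baseDegree (zeroDivisor k z) = Module.finrank k⟮z⟯ F := by
  refine le_antisymm (baseDegree_zeroDivisor_le hz) ?_
  have hz' : Transcendental k z⁻¹ := fun h => hz (by simpa using h.inv)
  have h1 := finrank_le_baseDegree hz'
  rw [inv_inv] at h1
  exact (finrank_le_baseDegree hz).trans ((baseDegree_zeroDivisor_le hz').trans h1)

theorem baseDegree_zeroDivisor_inv {z : F} (hz : Transcendental k z) :
    baseDegree (zeroDivisor k z⁻¹) = Module.finrank k⟮z⟯ F := by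
  have hz' : Transcendental k z⁻¹ := fun h => hz (by simpa using h.inv)
  refine le_antisymm ?_ (finrank_le_baseDegree hz)
  have h1 := finrank_le_baseDegree hz'
  rw [inv_inv] at h1
  exact (baseDegree_zeroDivisor_le hz').trans (h1.trans (baseDegree_zeroDivisor_le hz))

theorem baseDegree_principalDivisor (z : F) : baseDegree (principalDivisor k z) = 0 := by
  by_cases hz : Transcendental k z
  · rw [principalDivisor_eq, map_sub, baseDegree_zeroDivisor hz, baseDegree_zeroDivisor_inv hz,
      sub_self]
  · have h0 : principalDivisor k z = 0 := by
      ext P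
      by_cases hz0 : z = 0
      · simp [hz0, Place.ord]
      · have := P.valuation_eq_one_of_isAlgebraic (not_not.mp hz) hz0
        simp [Place.ord, this]
    rw [h0, map_zero]

theorem principalDivisor_mul {x y : F} (hx : x ≠ 0) (hy : y ≠ 0) :
    principalDivisor k (x * y) = principalDivisor k x + principalDivisor k y := by
  ext P
  simp [P.ord_mul hx hy]

theorem principalDivisor_inv (x : F) : principalDivisor k x⁻¹ = -principalDivisor k x := by
  ext P
  simp [P.ord_inv]

theorem exists_ne_zero_mem {A : Divisor k F} (h : 0 < Module.finrank k (riemannRochSpace A)) :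
    ∃ x : F, x ≠ 0 ∧ 0 ≤ A + principalDivisor k x := by
  have := Module.finrank_pos_iff.mp h
  obtain ⟨x, hx⟩ := exists_ne (0 : riemannRochSpace A)
  have hx0 : (x : F) ≠ 0 := fun h => hx (Subtype.ext h)
  exact ⟨x, hx0, (mem_riemannRochSpace_iff hx0).mp x.2⟩

/-- The difference `dim L(A) - deg A` does not increase as `A` grows, and it is at least `[F : k(t)]
- deg C` on the divisors `m (t)_∞ + C`. Every divisor is equivalent to one below some `m (t)_∞ + C`,
so the bound holds for all. -/
theorem exists_effective (k F : Type*) [Field k] [Field F] [Algebra k F]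
    [Algebra (RatFunc k) F] [IsScalarTower k (RatFunc k) F] [FunctionField k F] :
    ∃ B : ℤ, ∀ E : Divisor k F, B ≤ baseDegree E →
      ∃ x : F, x ≠ 0 ∧ 0 ≤ E + principalDivisor k x := by
  obtain ⟨t, ht⟩ := exists_transcendental k F
  obtain ⟨C, hC, h⟩ := exists_finrank_mul_le ht
  have hd := baseDegree_zeroDivisor_inv ht
  set D := zeroDivisor k t⁻¹ with hD
  set n := Module.finrank k⟮t⟯ F with hn
  have hn0 : 0 < n := by
    have := FunctionField.finiteDimensional_of_adjoin_transcendental ht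
    exact Module.finrank_pos
  refine ⟨baseDegree C, fun E hE => ?_⟩
  -- an element of `L(m D + C - E)` for large `m`
  set m := (baseDegree (E ⊔ 0)).toNat with hm
  have hm' : (m : ℤ) = baseDegree (E ⊔ 0) := Int.toNat_of_nonneg (baseDegree_nonneg le_sup_right)
  have h1 := finrank_riemannRochSpace_le_add (A := m • D + C - (E ⊔ 0)) (B := m • D + C)
    (sub_le_self _ le_sup_right)
  rw [sub_sub_cancel] at h1
  have h2 := h m
  zify at h2
  obtain ⟨x, hx0, hx⟩ := exists_ne_zero_mem (A := m • D + C - (E ⊔ 0)) (by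
    zify; nlinarith)
  have h3 : E - principalDivisor k x ≤ m • D + C := by
    have : (0 : Divisor k F) ≤ E ⊔ 0 - E := sub_nonneg.mpr le_sup_left
    have := add_nonneg hx this
    rw [← sub_nonneg]
    rwa [show m • D + C - (E - principalDivisor k x) =
      m • D + C - (E ⊔ 0) + principalDivisor k x + (E ⊔ 0 - E) by abel]
  -- This gives `dim L(E - (x)) ≥ n + deg E - deg C`, which is positive.
  have h4 := finrank_riemannRochSpace_le_add h3
  simp only [map_sub, map_add, map_nsmul, baseDegree_principalDivisor, hd, nsmul_eq_mul] at h4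
  obtain ⟨w, hw0, hw⟩ := exists_ne_zero_mem (A := E - principalDivisor k x) (by
    zify; nlinarith)
  refine ⟨w * x⁻¹, mul_ne_zero hw0 (inv_ne_zero hx0), ?_⟩
  rw [principalDivisor_mul hw0 (inv_ne_zero hx0), principalDivisor_inv]
  rwa [add_comm (principalDivisor k w), ← add_assoc, ← sub_eq_add_neg]

/-! ### Finiteness over a finite field -/

section Finite

variable [Finite k]

instance (P : Place k F) : Finite (IsLocalRing.ResidueField P.ring) := Module.finite_of_finite k

/-- Such a residue field has at most `q ^ b` elements, where `q` is the size of `k`, so the order of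
its unit group divides `N = (q ^ b)!`. Hence each such place is a pole of `t` or a zero of the fixed
nonzero element `t ^ (N + 1) - t`. -/
theorem finite_setOf_residueDegree_le (b : ℕ) :
    {P : Place k F | P.residueDegree ≤ b}.Finite := by
  obtain ⟨t, ht⟩ := exists_transcendental k F
  have ht0 : t ≠ 0 := fun h => ht (h ▸ isAlgebraic_zero)
  set N := (Nat.card k ^ b).factorial with hN
  have hN0 : 0 < N := Nat.factorial_pos _
  have hy : t ^ (N + 1) - t ≠ 0 := by
    intro h
    have h1 : aeval t (X ^ (N + 1) - X : k[X]) = 0 := by simpa using h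
    have h2 := congrArg (fun p => coeff p 1) (transcendental_iff.mp ht _ h1)
    simp [coeff_X_pow, hN0.ne'] at h2
  refine ((finite_setOf_valuation_lt_one hy).union
    (finite_setOf_valuation_lt_one (inv_ne_zero ht0))).subset fun P hP => ?_
  by_cases htP : P.valuation t ≤ 1
  · left
    have hmem := P.valuation_le_one_iff.mp htP
    let τ : P.ring := ⟨t, hmem⟩
    change P.valuation ((τ ^ (N + 1) - τ : P.ring) : F) < 1
    rw [P.valuation_coe_lt_one_iff, ← IsLocalRing.residue_eq_zero_iff, map_sub, map_pow]
    set r := IsLocalRing.residue P.ring τ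
    by_cases hr : r = 0
    · simp [hr]
    have := Fintype.ofFinite (IsLocalRing.ResidueField P.ring)
    have hc : Nat.card (IsLocalRing.ResidueField P.ring) ≤ Nat.card k ^ b := by
      rw [Module.natCard_eq_pow_finrank (K := k)]
      exact Nat.pow_le_pow_right Nat.card_pos hP
    have hd : Fintype.card (IsLocalRing.ResidueField P.ring) - 1 ∣ N := by
      refine Nat.dvd_factorial ?_ ?_
      · have := Fintype.one_lt_card (α := IsLocalRing.ResidueField P.ring)
        omega
      · rw [Nat.card_eq_fintype_card] at hc
        omega
    obtain ⟨c, hc⟩ := hd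
    rw [pow_succ, hc, pow_mul, FiniteField.pow_card_sub_one_eq_one r hr, one_pow, one_mul, sub_self]
  · right
    change P.valuation t⁻¹ < 1
    rw [map_inv₀]
    exact inv_lt_one_of_one_lt₀ (not_le.mp htP)

/-- Each term `D P * deg P` is at most `b`, which bounds both the coefficients and the degrees of
the places in the support. -/
theorem finite_setOf_effective (b : ℤ) :
    {D : Divisor k F | 0 ≤ D ∧ baseDegree D ≤ b}.Finite := by
  classical
  let S := (finite_setOf_residueDegree_le (k := k) (F := F) b.toNat).toFinset
  refine (Finset.finite_toSet (Finset.finsupp S fun _ => Finset.Icc 0 b)).subset ?_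
  rintro D ⟨hD, hDb⟩
  have h : ∀ P, D P * P.residueDegree ≤ b := fun P => by
    by_cases hP : P ∈ D.support
    · refine le_trans ?_ hDb
      exact Finset.single_le_sum (f := fun P => D P * (P.residueDegree : ℤ))
        (fun P _ => mul_nonneg (hD P) (Int.natCast_nonneg _)) hP
    · rw [Finsupp.notMem_support_iff.mp hP, zero_mul]
      exact (baseDegree_nonneg hD).trans hDb
  rw [Finset.mem_coe, Finset.mem_finsupp_iff]
  refine ⟨fun P hP => ?_, fun P _ => ?_⟩
  · have h1 : D P ≠ 0 := Finsupp.mem_support_iff.mp hP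
    have h2 : 0 ≤ D P := hD P
    have h3 : 1 ≤ D P := by omega
    have h4 := h P
    simp only [S, Set.Finite.mem_toFinset, Set.mem_ofPred_eq]
    have : (P.residueDegree : ℤ) ≤ b := by nlinarith [Int.natCast_nonneg P.residueDegree]
    omega
  · have h3 := P.residueDegree_pos
    have h2 : 0 ≤ D P := hD P
    exact Finset.mem_Icc.mpr ⟨h2, by nlinarith [h P]⟩

end Finite

end

/-! ### Degrees over the constant field and finite indices -/

section

/-- Only separation of cosets is asked of `φ`, not additivity: the maps used below depend on choices
of functions. -/
theorem relIndex_ne_zero_of_map {G : Type*} [AddCommGroup G] (H K : AddSubgroup G) {α : Type*}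
    [Finite α] (φ : K → α) (h : ∀ x y : K, φ x = φ y → (x - y : G) ∈ H) : H.relIndex K ≠ 0 := by
  have : Finite (K ⧸ H.addSubgroupOf K) :=
    Finite.of_injective (fun x : K ⧸ H.addSubgroupOf K => φ x.out) fun x y hxy => by
      rw [← QuotientAddGroup.out_eq' x, ← QuotientAddGroup.out_eq' y, eq_comm,
        QuotientAddGroup.eq, neg_add_eq_sub, AddSubgroup.mem_addSubgroupOf]
      exact h _ _ hxy
  exact AddSubgroup.index_ne_zero_of_finite

variable {k F : Type*} [Field k] [Field F] [Algebra k F]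

theorem Place.residueDegree_eq (P : Place k F) :
    P.residueDegree = Module.finrank k (constantField k F) * P.degree := by
  let _ := P.constantToResidue.toAlgebra
  have : IsScalarTower k (constantField k F) (IsLocalRing.ResidueField P.ring) :=
    IsScalarTower.of_algebraMap_eq fun _ => rfl
  exact (Module.finrank_mul_finrank _ _ _).symm

theorem baseDegree_eq (D : Divisor k F) :
    baseDegree D = Module.finrank k (constantField k F) * D.degree := by
  rw [baseDegree_apply, Divisor.degree, Finsupp.mul_sum]
  refine Finset.sum_congr rfl fun P _ => ?_
  dsimp only
  rw [P.residueDegree_eq]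
  push_cast
  ring

variable [Algebra (RatFunc k) F] [IsScalarTower k (RatFunc k) F] [FunctionField k F]

theorem baseDegree_ne_zero_iff (D : Divisor k F) : baseDegree D ≠ 0 ↔ D.degree ≠ 0 := by
  obtain ⟨P⟩ := nonempty_place k F
  have h := P.residueDegree_pos
  rw [P.residueDegree_eq] at h
  -- This degree divides the positive residue degree of a place.
  have hc : (Module.finrank k (constantField k F) : ℤ) ≠ 0 := by
    exact_mod_cast (Nat.pos_of_mul_pos_right h).ne'
  rw [baseDegree_eq, mul_ne_zero_iff, and_iff_right hc]

theorem exists_place_notMem (S : Finset (Place k F)) : ∃ P : Place k F, P ∉ S := by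
  -- Transcendence of `y` below comes from a pole at some `Q ∈ S`.
  rcases S.eq_empty_or_nonempty with rfl | ⟨Q, hQ⟩
  · obtain ⟨P⟩ := nonempty_place k F
    exact ⟨P, Finset.notMem_empty P⟩
  choose x hx using fun P : Place k F => P.exists_valuation_eq 1
  obtain ⟨y, hy⟩ := exists_valuation_sub_le S x 0
  have h1 : ∀ P ∈ S, 1 < P.valuation y := fun P hP => by
    have h2 : (1 : ℤᵐ⁰) < WithZero.exp 1 := by
      rw [← WithZero.exp_zero, WithZero.exp_lt_exp]; norm_num
    by_contra! h
    have h3 : P.valuation (x P) ≤ 1 := by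
      rw [← sub_sub_cancel y (x P)]
      exact P.valuation.map_sub_le h (hy P hP)
    rw [hx] at h3
    exact h3.not_gt h2
  have hty : Transcendental k y := fun h =>
    (h1 Q hQ).ne' (Q.valuation_eq_one_of_isAlgebraic h fun h0 => by
      have := h1 Q hQ
      simp [h0] at this)
  obtain ⟨P, hP⟩ := exists_place_of_transcendental hty
  rw [← P.valuation_lt_one_iff] at hP
  exact ⟨P, fun h => (h1 P h).not_gt hP⟩

theorem isDivisorOf_iff {D : Divisor k F} {f : F} :
    IsDivisorOf D f ↔ D = principalDivisor k f :=
  ⟨fun h => Finsupp.ext h, fun h P => by rw [h]; rfl⟩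

/-- The group of principal divisors. -/
def principalDivisors (k F : Type*) [Field k] [Field F] [Algebra k F]
    [Algebra (RatFunc k) F] [IsScalarTower k (RatFunc k) F] [FunctionField k F] :
    AddSubgroup (Divisor k F) where
  carrier := {D | ∃ f : F, f ≠ 0 ∧ D = principalDivisor k f}
  zero_mem' := ⟨1, one_ne_zero, by ext P; simp [P.ord_one]⟩
  add_mem' := by
    rintro _ _ ⟨f, hf, rfl⟩ ⟨g, hg, rfl⟩
    exact ⟨f * g, mul_ne_zero hf hg, (principalDivisor_mul hf hg).symm⟩
  neg_mem' := by
    rintro _ ⟨f, hf, rfl⟩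
    exact ⟨f⁻¹, inv_ne_zero hf, (principalDivisor_inv f).symm⟩

variable [Finite k]

/-- Choose a function for each divisor; it is a unit at every place of `m`. If two functions agree
modulo an element of order `m P` at each such `P`, their quotient is congruent to `1` modulo `m`.
The residue rings are finite. -/
theorem relIndex_rayPrincipalDivisors_ne_zero {m : Divisor k F} (hm : 0 ≤ m) :
    (rayPrincipalDivisors m).relIndex
      ((principalDivisors k F).comap (divisorsPrimeTo m).subtype) ≠ 0 := by
  set Q := (principalDivisors k F).comap (divisorsPrimeTo m).subtype
  choose f hf0 hf using fun D : Q => D.2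
  have hv : ∀ (D : Q), ∀ P ∈ m.support, P.valuation (f D) = 1 := fun D P hP => by
    refine P.valuation_eq_one (hf0 D) ?_
    rw [← principalDivisor_apply, ← hf D]
    exact apply_eq_zero_of_mem D.1.2 hP
  choose a ha using fun P : Place k F => P.exists_valuation_eq (-m P)
  have ha1 : ∀ P ∈ m.support, P.valuation (a P) < 1 := fun P hP => by
    have h1 : m P ≠ 0 := Finsupp.mem_support_iff.mp hP
    have h2 : 0 ≤ m P := hm P
    rw [ha, ← WithZero.exp_zero, WithZero.exp_lt_exp]
    omega
  let a' : ∀ P : m.support, (P : Place k F).ring := fun P =>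
    ⟨a P, (P : Place k F).valuation_le_one_iff.mp (ha1 P P.2).le⟩
  have hfin : ∀ P : m.support, Finite ((P : Place k F).ring ⧸ Ideal.span {a' P}) := fun P => by
    have := (P : Place k F).finite_quotient (x := a' P) (fun h => by
      have h1 := ha P
      rw [show a P = 0 from congrArg Subtype.val h, map_zero] at h1
      exact WithZero.exp_ne_zero h1.symm)
      ((P : Place k F).valuation_coe_lt_one_iff.mp (ha1 P P.2))
    exact Module.finite_of_finite k
  let φ : Q → ∀ P : m.support, (P : Place k F).ring ⧸ Ideal.span {a' P} := fun D P =>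
    Ideal.Quotient.mk _ ⟨f D, (P : Place k F).valuation_le_one_iff.mp (hv D P P.2).le⟩
  refine relIndex_ne_zero_of_map _ _ φ fun D E h =>
    ⟨f D * (f E)⁻¹, mul_ne_zero (hf0 D) (inv_ne_zero (hf0 E)), ?_, fun P hP => ?_⟩
  · rw [isDivisorOf_iff, principalDivisor_mul (hf0 D) (inv_ne_zero (hf0 E)),
      principalDivisor_inv, ← hf, ← hf, ← sub_eq_add_neg]
    rfl
  · have h1 := Ideal.Quotient.eq.mp (congrFun h ⟨P, hP⟩)
    obtain ⟨w, hw⟩ := Ideal.mem_span_singleton.mp h1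
    have h2 : f D - f E = a P * w := congrArg Subtype.val hw
    rw [P.congrOne_iff, show f D * (f E)⁻¹ - 1 = (f D - f E) * (f E)⁻¹ by
      rw [sub_mul, mul_inv_cancel₀ (hf0 E)], h2, map_mul, map_mul, map_inv₀, hv E P hP, inv_one,
      mul_one, ha]
    exact mul_le_of_le_one_right' (P.valuation_le_one_iff.mpr w.2)

theorem index_sup_ne_zero {m : Divisor k F} {H : AddSubgroup (divisorsPrimeTo m)}
    {D : divisorsPrimeTo m} (hD : D ∈ H) (hd : baseDegree (D : Divisor k F) ≠ 0) :
    (H ⊔ (principalDivisors k F).comap (divisorsPrimeTo m).subtype).index ≠ 0 := by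
  obtain ⟨B, hB⟩ := exists_effective k F
  set d := baseDegree (D : Divisor k F) with hd_def
  -- Division with remainder by `d`, of either sign, puts the degree of `g + n g • D` in `[B, B +
  -- |d|)`.
  let n : divisorsPrimeTo m → ℤ := fun g => -((baseDegree (g : Divisor k F) - B) / d)
  have hn : ∀ g, baseDegree ((g + n g • D : divisorsPrimeTo m) : Divisor k F) =
      B + (baseDegree (g : Divisor k F) - B) % d := fun g => by
    have := Int.emod_add_mul_ediv (baseDegree (g : Divisor k F) - B) d
    simp only [AddSubgroup.coe_add, AddSubgroup.coe_zsmul, map_add, map_zsmul, ← hd_def, n,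
      smul_eq_mul]
    linarith
  choose x hx0 hx using fun g : divisorsPrimeTo m =>
    hB (g + n g • D : divisorsPrimeTo m) (by
      rw [hn]; linarith [Int.emod_nonneg (baseDegree (g : Divisor k F) - B) hd])
  have hfin := (finite_setOf_effective (k := k) (F := F) (B + |d|)).to_subtype
  -- The effective divisor need not be prime to `m`. Only differences matter: two elements with the
  -- same image differ by a multiple of `D` plus a principal divisor prime to `m`.
  let φ : (⊤ : AddSubgroup (divisorsPrimeTo m)) →
      {D : Divisor k F | 0 ≤ D ∧ baseDegree D ≤ B + |d|} := fun g => ⟨_, hx g.1, by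
    rw [map_add, baseDegree_principalDivisor, add_zero, hn]
    linarith [Int.emod_lt_abs (baseDegree (g.1 : Divisor k F) - B) hd]⟩
  rw [← AddSubgroup.relIndex_top_right]
  refine relIndex_ne_zero_of_map _ _ φ ?_
  rintro ⟨g, _⟩ ⟨h, _⟩ hgh
  have h1 : ((g + n g • D : divisorsPrimeTo m) : Divisor k F) + principalDivisor k (x g) =
      ((h + n h • D : divisorsPrimeTo m) : Divisor k F) + principalDivisor k (x h) :=
    congrArg Subtype.val hgh
  have h2 : (g + n g • D) - (h + n h • D) ∈
      (principalDivisors k F).comap (divisorsPrimeTo m).subtype := by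
    refine ⟨x h * (x g)⁻¹, mul_ne_zero (hx0 h) (inv_ne_zero (hx0 g)), ?_⟩
    rw [principalDivisor_mul (hx0 h) (inv_ne_zero (hx0 g)), principalDivisor_inv,
      ← sub_eq_add_neg, map_sub, sub_eq_sub_iff_add_eq_add]
    exact h1.trans (add_comm _ _)
  have h3 : (n h - n g) • D ∈ H := zsmul_mem hD _
  have h4 := add_mem (AddSubgroup.mem_sup_left h3) (AddSubgroup.mem_sup_right (S := H) h2)
  change g - h ∈ _
  rwa [show g - h = (n h - n g) • D + (g + n g • D - (h + n h • D)) by rw [sub_smul]; abel]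

end

end GlobalFunctionField

end

/-! ### The finite index criterion -/

theorem proposition3 (k F : Type*) [Field k] [Finite k] [Field F] [Algebra k F]
    [Algebra (RatFunc k) F] [IsScalarTower k (RatFunc k) F] [FunctionField k F]
    (m : GlobalFunctionField.Divisor k F) (hm : 0 ≤ m)
    (H : AddSubgroup (GlobalFunctionField.RayClassGroup m)) :
    H.FiniteIndex ↔
      ∃ D : GlobalFunctionField.divisorsPrimeTo m,
        (QuotientAddGroup.mk D : GlobalFunctionField.RayClassGroup m) ∈ H ∧
          GlobalFunctionField.Divisor.degree (D : GlobalFunctionField.Divisor k F) ≠ 0 := by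
  constructor
  · intro hH
    obtain ⟨P, hP⟩ := GlobalFunctionField.exists_place_notMem m.support
    have hmem : Finsupp.single P 1 ∈ GlobalFunctionField.divisorsPrimeTo m := by
      refine Finset.disjoint_of_subset_left Finsupp.support_single_subset ?_
      rwa [Finset.disjoint_singleton_left]
    refine ⟨H.index • ⟨Finsupp.single P 1, hmem⟩, ?_, ?_⟩
    · exact H.nsmul_index_mem (QuotientAddGroup.mk ⟨Finsupp.single P 1, hmem⟩)
    · rw [← GlobalFunctionField.baseDegree_ne_zero_iff, AddSubgroup.coe_nsmul, map_nsmul,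
        GlobalFunctionField.baseDegree_single, one_mul,
        nsmul_eq_mul]
      exact_mod_cast mul_ne_zero hH.index_ne_zero P.residueDegree_pos.ne'
  · rintro ⟨D, hD, hd⟩
    rw [← GlobalFunctionField.baseDegree_ne_zero_iff] at hd
    rw [AddSubgroup.finiteIndex_iff,
      ← AddSubgroup.index_comap_of_surjective H (QuotientAddGroup.mk'_surjective _)]
    set H' := H.comap (QuotientAddGroup.mk' (GlobalFunctionField.rayPrincipalDivisors m))
    have hle : GlobalFunctionField.rayPrincipalDivisors m ≤ H' := fun x hx => by
      have : (QuotientAddGroup.mk x : GlobalFunctionField.RayClassGroup m) = 0 :=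
        (QuotientAddGroup.eq_zero_iff x).mpr hx
      rw [AddSubgroup.mem_comap, QuotientAddGroup.mk'_apply, this]
      exact zero_mem H
    set Q := (GlobalFunctionField.principalDivisors k F).comap
      (GlobalFunctionField.divisorsPrimeTo m).subtype
    -- The index of `H'` splits along `H' ≤ H' ⊔ Q`, and `[H' ⊔ Q : H']` equals the relative index
    -- of `H'` in `Q`. The latter is nonzero since it is so for the smaller group of ray principal
    -- divisors.
    rw [← AddSubgroup.relIndex_mul_index (le_sup_left : H' ≤ H' ⊔ Q), sup_comm,
      AddSubgroup.relIndex_sup_right, sup_comm]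
    refine mul_ne_zero (fun h => GlobalFunctionField.relIndex_rayPrincipalDivisors_ne_zero hm ?_)
      (GlobalFunctionField.index_sup_ne_zero (D := D) hD hd)
    exact AddSubgroup.relIndex_eq_zero_of_le_left hle h
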